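/- Let $m,n$ be integers. Let $S(m,n)$ be the knot which bounds the following surface in $S^3$: a disc with two bands attached along its upper side, the feet of the bands occurring in the order left foot of the left band, left foot of the right band, right foot of the left band, right foot of the right band; there is a single negative half-twist between the two bands (the right leg of the left band passes over the left leg of the right band), the left band has $m$ full twists and the right band has $n$ full twists (right-handed if the number is positive, left-handed if it is negative). With respect to the cores of the bands, suitably oriented, the Seifert matrix of this surface is $\begin{pmatrix} m & 1\\ 0 & n\end{pmatrix}$. Let $p$ be an odd positive integer and let $D_{2p}=\langle t,s \mid t^2=s^p=1,\ tst=s^{p-1}\rangle$ be the dihedral group of order $2p$. A $p$-colouring of a knot $K\subset S^3$ is a surjective homomorphism from the knot group of $K$, $\pi_1(S^3\setminus K)$, which is given by the Wirtinger presentation of any diagram of $K$, to $D_{2p}$, and $K$ is called $p$-colourable if it has a $p$-colouring. Then $S(m,n)$ is $p$-colourable if and only if $4mn\equiv 1 \pmod p$. Moreover, if $4mn\not\equiv 1 \pmod{p^2}$, then a $p$-colouring of $S(m,n)$ is unique up to automorphisms of $D_{2p}$: for any two $p$-colourings $\rho,\rho'$ of $S(m,n)$ there is an automorphism $\varphi$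 of $D_{2p}$ with $\rho'=\varphi\circ\rho$. -/

import Mathlib

/-!
Knots and links are given by diagrams in the plane, in general position with respect to the
height function and read from top to bottom.  The group of a link is the group of its diagram in
Wirtinger's sense: one generator for each piece of strand, with the relations at the crossings,
and with the relations which identify the two ends of a local maximum or minimum.
-/

/-- The elementary pieces of a diagram.  The strands at a given height are numbered
`0, 1, 2, …` from left to right.
* `localMax i`: a local maximum; two new strands appear, at the positions `i` and `i + 1`;
* `localMin i`: a local minimum; the strands `i` and `i + 1` are joined and end;
* `pos i`: the strands `i` and `i + 1` cross, and the strand running from the upper right to the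
  lower left passes over (a positive, or right-handed, half twist: the sign of the crossing is
  `+1` if both strands are oriented downwards);
* `neg i`: the strands `i` and `i + 1` cross, and the strand running from the upper left to the
  lower right passes over (a negative, or left-handed, half twist). -/
inductive DiagramPiece : Type
  | localMax (i : ℕ)
  | localMin (i : ℕ)
  | pos (i : ℕ)
  | neg (i : ℕ)

namespace DiagramPiece

/-- The piece can be placed below `w` strands. -/
def Fits : DiagramPiece → ℕ → Prop
  | localMax i, w => i ≤ w
  | localMin i, w => i + 2 ≤ w
  | pos i, w => i + 2 ≤ w
  | neg i, w => i + 2 ≤ w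

/-- The number of strands below the piece, if there are `w` strands above it. -/
def strandsBelow : DiagramPiece → ℕ → ℕ
  | localMax _, w => w + 2
  | localMin _, w => w - 2
  | pos _, w => w
  | neg _, w => w

/-- The relators contributed by one piece, where `x j` and `y j` are the elements of the `j`-th
strand just above and just below the piece.  The element of a strand is the class of the loop
which starts at the eye of the viewer, goes down to the left of the strand, passes underneath it
from left to right and returns to the eye; products of loops are read from left to right.
(If a strand is oriented downwards or upwards, its meridian is this element or its inverse.) -/
def relators {F : Type*} [Group F] : DiagramPiece → (ℕ → F) → (ℕ → F) → Set F
  | localMax i, x, y =>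
      {r | r = y i * y (i + 1) ∨ (∃ j < i, r = y j * (x j)⁻¹) ∨
        ∃ j ≥ i, r = y (j + 2) * (x j)⁻¹}
  | localMin i, x, y =>
      {r | r = x i * x (i + 1) ∨ (∃ j < i, r = y j * (x j)⁻¹) ∨
        ∃ j ≥ i, r = y j * (x (j + 2))⁻¹}
  | pos i, x, y =>
      {r | r = y i * (x (i + 1))⁻¹ ∨
        r = y (i + 1) * ((x (i + 1))⁻¹ * x i * x (i + 1))⁻¹ ∨
        ∃ j, (j < i ∨ i + 2 ≤ j) ∧ r = y j * (x j)⁻¹}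
  | neg i, x, y =>
      {r | r = y (i + 1) * (x i)⁻¹ ∨
        r = y i * (x i * x (i + 1) * (x i)⁻¹)⁻¹ ∨
        ∃ j, (j < i ∨ i + 2 ≤ j) ∧ r = y j * (x j)⁻¹}

/-- A list of pieces, stacked from top to bottom below `w` strands, fits together, and no strand
is left at the bottom. -/
def Closes : ℕ → List DiagramPiece → Prop
  | w, [] => w = 0
  | w, P :: L => P.Fits w ∧ Closes (P.strandsBelow w) L

/-- `k` half twists between the neighbouring strands `i` and `i + 1`, right-handed if `0 ≤ k` and
left-handed if `k < 0`. -/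
def halfTwists (i : ℕ) (k : ℤ) : List DiagramPiece :=
  if 0 ≤ k then List.replicate k.natAbs (pos i) else List.replicate k.natAbs (neg i)

theorem closes_halfTwists_append {i w : ℕ} (h : i + 2 ≤ w) (k : ℤ) {L : List DiagramPiece}
    (hL : Closes w L) : Closes w (halfTwists i k ++ L) := by
  unfold halfTwists
  split_ifs
  · induction k.natAbs with
    | zero => exact hL
    | succ c ih => exact ⟨h, ih⟩
  · induction k.natAbs with
    | zero => exact hL
    | succ c ih => exact ⟨h, ih⟩

end DiagramPiece

/-- A (nonoriented) link diagram. -/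
structure LinkDiagram where
  pieces : List DiagramPiece
  closes : DiagramPiece.Closes 0 pieces

namespace LinkDiagram

/-- The number of strands on level `t`, that is, just below the first `t` pieces. -/
def width (D : LinkDiagram) (t : ℕ) : ℕ :=
  (D.pieces.take t).foldl (fun w P => P.strandsBelow w) 0

/-- The pairs `(t, j)` such that there is a `j`-th strand on level `t`. -/
def Strand (D : LinkDiagram) : Type := {q : ℕ × ℕ // q.2 < D.width q.1}

/-- The generator of the `j`-th strand on level `t` (and `1` if there is no such strand). -/
def strand (D : LinkDiagram) (t j : ℕ) : FreeGroup D.Strand :=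
  if h : j < D.width t then FreeGroup.of ⟨(t, j), h⟩ else 1

/-- The Wirtinger relators of the diagram. -/
def relators (D : LinkDiagram) : Set (FreeGroup D.Strand) :=
  {r | ∃ (t : ℕ) (h : t < D.pieces.length),
    r ∈ (D.pieces[t]).relators (D.strand t) (D.strand (t + 1))}

/-- The group of the link (the fundamental group of its complement in the `3`-sphere), through
the Wirtinger presentation given by the diagram. -/
abbrev LinkGroup (D : LinkDiagram) : Type := PresentedGroup D.relators

/-- A `p`-colouring: a surjective homomorphism from the group of the link to the dihedral group
of order `2p`. -/
structure PColouring (D : LinkDiagram) (p : ℕ) where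
  hom : D.LinkGroup →* DihedralGroup p
  surjective : Function.Surjective hom

/-- The link admits a `p`-colouring. -/
def PColourable (D : LinkDiagram) (p : ℕ) : Prop := Nonempty (D.PColouring p)

end LinkDiagram

open DiagramPiece in
/-- The knot `S(m, n)`: the boundary of a disc with two bands attached along its upper side.  The
four feet of the bands follow each other as: left foot of the left band, left foot of the right
band, right foot of the left band, right foot of the right band.  There is one negative half
twist between the two bands (the right leg of the left band passes over the left leg of the right
band), the left band has `m` full twists, and the right band has `n` full twists. -/
def seifertKnot (m n : ℤ) : LinkDiagram where
  pieces :=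
    -- the two edges of the left band, as an arch
    [localMax 0, localMax 1] ++
    -- the two edges of the right band, as an arch to the right of it
    [localMax 4, localMax 5] ++
    -- the inner legs of the two bands (strands 2, 3 and 4, 5) cross
    [neg 3, neg 2, neg 4, neg 3] ++
    -- the full twists in the outer legs (strands 0, 1 and 6, 7)
    (halfTwists 0 (2 * m) ++ (halfTwists 6 (2 * n) ++
    -- the boundary of the disc: between neighbouring feet, and around the bottom
    [localMin 1, localMin 1, localMin 1, localMin 0]))
  closes := by
    have h : Closes 8 [localMin 1, localMin 1, localMin 1, localMin 0] := by
      simp [Closes, Fits, strandsBelow]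
    have h' : Closes 8 (halfTwists 0 (2 * m) ++ (halfTwists 6 (2 * n) ++
        [localMin 1, localMin 1, localMin 1, localMin 0])) :=
      closes_halfTwists_append (by norm_num) _ (closes_halfTwists_append (by norm_num) _ h)
    simpa [Closes, Fits, strandsBelow] using h'

/-! A homomorphism from the link group to `G` is a labelling of the strands that satisfies the
relations of all pieces. Except at a maximum, the labels below a piece are determined by those above
it, so for `S(m, n)` everything depends on the labels `a, b, c, d` of the four band edges under the
arches (`closure_meridians`). The only conditions come from the minima (`flows_lowerPieces`).
Crossing the bands conjugates `c, d` by `a * b`, and a full twist conjugates two strands by their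
product; this gives `Relations`.

In the dihedral group, `Relations` makes the four labels conjugate up to inversion, so under a
surjection all are reflections, with indices `α, β, γ, δ`. `Relations` is then linear over `ZMod p`
(`relations_sr`): `α, β` determine `γ, δ`, and `(4mn - 1)(β - α) = 0`. All indices agree modulo the
ideal generated by `β - α`, so surjectivity makes `β - α` a unit and `4mn = 1`. Conversely, `α = 0`,
`β = 1` gives a colouring. Finally, affine maps of the index, which are automorphisms, carry any
pair `(α, β)` with unit difference to any other. -/

namespace DiagramPiece

/-! ### Labels above and below a single piece -/

variable {G : Type*} [Group G]

/-- The elements `x j` and `y j` of the strands above and below the piece satisfy its relations. -/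
def Rel (P : DiagramPiece) (x y : ℕ → G) : Prop := ∀ r ∈ P.relators x y, r = 1

/-- Relators are words in the labels, so homomorphisms commute with them. This transports relations
between the free group, the link group and the target. -/
theorem image_relators {F : Type*} [Group F] (f : F →* G) (P : DiagramPiece) (x y : ℕ → F) :
    f '' P.relators x y = P.relators (fun j => f (x j)) (fun j => f (y j)) := by
  have himage : ∀ (p : F → Prop) (q : G → Prop), (∀ r, p r → q (f r)) →
      (∀ s, q s → ∃ r, p r ∧ f r = s) → f '' {r | p r} = {s | q s} := by
    intro p q h h'
    ext s
    exact ⟨fun ⟨r, hr, hs⟩ => hs ▸ h r hr, fun hs => h' s hs⟩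
  cases P <;> refine himage _ _ ?_ ?_
  all_goals rintro _ (rfl | ⟨j, hj, rfl⟩ | ⟨j, hj, rfl⟩)
  all_goals first
    | (refine Or.inl ?_; simp; done)
    | (refine Or.inr (Or.inl ?_); simp; done)
    | (refine Or.inr (Or.inl ⟨j, hj, ?_⟩); simp)
    | (refine Or.inr (Or.inr ⟨j, hj, ?_⟩); simp)
    | (refine ⟨_, Or.inl rfl, ?_⟩; simp; done)
    | (refine ⟨_, Or.inr (Or.inl rfl), ?_⟩; simp; done)
    | (refine ⟨_, Or.inr (Or.inl ⟨j, hj, rfl⟩), ?_⟩; simp)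
    | (refine ⟨_, Or.inr (Or.inr ⟨j, hj, rfl⟩), ?_⟩; simp)

theorem rel_localMax {i : ℕ} {x y : ℕ → G} :
    (localMax i).Rel x y ↔
      y = fun j => if j < i then x j else if j = i then y i else if j = i + 1 then (y i)⁻¹
        else x (j - 2) := by
  constructor
  · intro h
    funext j
    split_ifs with h1 h2 h3
    · exact mul_inv_eq_one.1 (h _ (Or.inr (Or.inl ⟨j, h1, rfl⟩)))
    · rw [h2]
    · rw [h3]
      exact eq_inv_of_mul_eq_one_right (h _ (Or.inl rfl))
    · obtain ⟨k, rfl⟩ : ∃ k, j = k + 2 := ⟨j - 2, by omega⟩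
      exact mul_inv_eq_one.1 (h _ (Or.inr (Or.inr ⟨k, by omega, rfl⟩)))
  · rintro h _ (rfl | ⟨j, hj, rfl⟩ | ⟨j, hj, rfl⟩)
    · rw [congrFun h (i + 1)]
      simp
    · rw [congrFun h j]
      simp [hj]
    · rw [congrFun h (j + 2)]
      have h1 : ¬ j + 2 < i := by omega
      have h2 : ¬ j + 2 = i := by omega
      have h3 : ¬ j + 2 = i + 1 := by omega
      simp [h1, h2, h3]

theorem rel_localMin {i : ℕ} {x y : ℕ → G} :
    (localMin i).Rel x y ↔
      x i * x (i + 1) = 1 ∧ y = fun j => if j < i then x j else x (j + 2) := by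
  constructor
  · intro h
    refine ⟨h _ (Or.inl rfl), ?_⟩
    funext j
    split_ifs with h1
    · exact mul_inv_eq_one.1 (h _ (Or.inr (Or.inl ⟨j, h1, rfl⟩)))
    · exact mul_inv_eq_one.1 (h _ (Or.inr (Or.inr ⟨j, by omega, rfl⟩)))
  · rintro ⟨h, rfl⟩ _ (rfl | ⟨j, hj, rfl⟩ | ⟨j, hj, rfl⟩)
    · exact h
    · simp [hj]
    · simp [Nat.not_lt.2 hj]

theorem rel_pos {i : ℕ} {x y : ℕ → G} :
    (pos i).Rel x y ↔
      y = fun j => if j = i then x (i + 1)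
        else if j = i + 1 then (x (i + 1))⁻¹ * x i * x (i + 1) else x j := by
  constructor
  · intro h
    funext j
    split_ifs with h1 h2
    · subst h1
      exact mul_inv_eq_one.1 (h _ (Or.inl rfl))
    · subst h2
      exact mul_inv_eq_one.1 (h _ (Or.inr (Or.inl rfl)))
    · exact mul_inv_eq_one.1 (h _ (Or.inr (Or.inr ⟨j, by omega, rfl⟩)))
  · rintro rfl _ (rfl | rfl | ⟨j, hj, rfl⟩)
    · simp
    · simp
    · have h1 : ¬ j = i := by omega
      have h2 : ¬ j = i + 1 := by omega
      simp [h1, h2]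

theorem rel_neg {i : ℕ} {x y : ℕ → G} :
    (neg i).Rel x y ↔
      y = fun j => if j = i then x i * x (i + 1) * (x i)⁻¹ else if j = i + 1 then x i
        else x j := by
  constructor
  · intro h
    funext j
    split_ifs with h1 h2
    · subst h1
      exact mul_inv_eq_one.1 (h _ (Or.inr (Or.inl rfl)))
    · subst h2
      exact mul_inv_eq_one.1 (h _ (Or.inl rfl))
    · exact mul_inv_eq_one.1 (h _ (Or.inr (Or.inr ⟨j, by omega, rfl⟩)))
  · rintro rfl _ (rfl | rfl | ⟨j, hj, rfl⟩)
    · simp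
    · simp
    · have h1 : ¬ j = i := by omega
      have h2 : ¬ j = i + 1 := by omega
      simp [h1, h2]

theorem Rel.mem_below {P : DiagramPiece} {x y : ℕ → G} (h : P.Rel x y)
    (hP : ∀ i, P ≠ localMax i) {H : Subgroup G} (hx : ∀ j, x j ∈ H) (j : ℕ) : y j ∈ H := by
  cases P with
  | localMax i => exact absurd rfl (hP i)
  | localMin i =>
    rw [(rel_localMin.1 h).2]
    dsimp only
    split_ifs <;> exact hx _
  | pos i =>
    rw [rel_pos.1 h]
    dsimp only
    split_ifs
    exacts [hx _, H.mul_mem (H.mul_mem (H.inv_mem (hx _)) (hx _)) (hx _), hx _]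
  | neg i =>
    rw [rel_neg.1 h]
    dsimp only
    split_ifs
    exacts [H.mul_mem (H.mul_mem (hx _) (hx _)) (H.inv_mem (hx _)), hx _, hx _]

theorem Rel.mem_above_localMax {i : ℕ} {x y : ℕ → G} (h : (localMax i).Rel x y)
    {H : Subgroup G} (hy : ∀ j, y j ∈ H) (j : ℕ) : x j ∈ H := by
  rcases lt_or_ge j i with hj | hj
  · rw [← mul_inv_eq_one.1 (h _ (Or.inr (Or.inl ⟨j, hj, rfl⟩)))]
    exact hy _
  · rw [← mul_inv_eq_one.1 (h _ (Or.inr (Or.inr ⟨j, hj, rfl⟩)))]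
    exact hy _

/-- States are indexed by all of `ℕ`; positions without a strand carry the default label `1`, and
every piece preserves this convention. -/
theorem Rel.eq_one_of_le {P : DiagramPiece} {x y : ℕ → G} (h : P.Rel x y) {w : ℕ}
    (hP : P.Fits w) (hx : ∀ j, w ≤ j → x j = 1) (j : ℕ) (hj : P.strandsBelow w ≤ j) :
    y j = 1 := by
  cases P with
  | localMax i =>
    simp only [Fits, strandsBelow] at hP hj
    rw [rel_localMax.1 h]
    dsimp only
    rw [if_neg (by omega), if_neg (by omega), if_neg (by omega)]
    exact hx _ (by omega)
  | localMin i =>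
    simp only [Fits, strandsBelow] at hP hj
    rw [(rel_localMin.1 h).2]
    dsimp only
    rw [if_neg (by omega)]
    exact hx _ (by omega)
  | pos i =>
    simp only [Fits, strandsBelow] at hP hj
    rw [rel_pos.1 h]
    dsimp only
    rw [if_neg (by omega), if_neg (by omega)]
    exact hx _ (by omega)
  | neg i =>
    simp only [Fits, strandsBelow] at hP hj
    rw [rel_neg.1 h]
    dsimp only
    rw [if_neg (by omega), if_neg (by omega)]
    exact hx _ (by omega)

/-! ### Stacks of pieces -/

/-- The states `X 0, X 1, …` on the successive levels satisfy the relations of the stacked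
pieces. -/
def Chain (L : List DiagramPiece) (X : ℕ → ℕ → G) : Prop :=
  ∀ (t : ℕ) (h : t < L.length), (L[t]).Rel (X t) (X (t + 1))

/-- The state `x` above the stacked pieces can be continued to the state `y` below them. -/
def Flows : List DiagramPiece → (ℕ → G) → (ℕ → G) → Prop
  | [], x, y => y = x
  | P :: L, x, y => ∃ z, P.Rel x z ∧ Flows L z y

theorem chain_cons {P : DiagramPiece} {L : List DiagramPiece} {X : ℕ → ℕ → G} :
    Chain (P :: L) X ↔ P.Rel (X 0) (X 1) ∧ Chain L (fun t => X (t + 1)) := by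
  constructor
  · intro h
    exact ⟨h 0 (by simp), fun t ht => h (t + 1) (by simpa using ht)⟩
  · rintro ⟨h0, h⟩ t ht
    cases t with
    | zero => exact h0
    | succ t => exact h t (by simpa using ht)

theorem Chain.flows {L : List DiagramPiece} {X : ℕ → ℕ → G} (h : Chain L X) :
    Flows L (X 0) (X L.length) := by
  induction L generalizing X with
  | nil => rfl
  | cons P L ih => exact ⟨X 1, (chain_cons.1 h).1, ih (chain_cons.1 h).2⟩

theorem Flows.exists_chain {L : List DiagramPiece} {x y : ℕ → G} (h : Flows L x y) :
    ∃ X, Chain L X ∧ X 0 = x := by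
  induction L generalizing x with
  | nil => exact ⟨fun _ => x, fun t ht => absurd ht (by simp), rfl⟩
  | cons P L ih =>
    obtain ⟨z, hz, hL⟩ := h
    obtain ⟨X, hX, rfl⟩ := ih hL
    refine ⟨fun t => Nat.casesOn t x X, chain_cons.2 ⟨hz, hX⟩, rfl⟩

theorem chain_append {L L' : List DiagramPiece} {X : ℕ → ℕ → G} :
    Chain (L ++ L') X ↔ Chain L X ∧ Chain L' (fun t => X (t + L.length)) := by
  induction L generalizing X with
  | nil => exact ⟨fun h => ⟨fun t ht => absurd ht (by simp), h⟩, fun h => h.2⟩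
  | cons P L ih =>
    rw [List.cons_append, chain_cons, chain_cons, ih, and_assoc]
    simp only [List.length_cons, add_assoc]

/-- Keeps track of the state at the joint, so that a labelling can be built with prescribed labels
below the arches. -/
theorem Flows.exists_chain_append {L L' : List DiagramPiece} {x y z : ℕ → G}
    (h : Flows L x y) (h' : Flows L' y z) :
    ∃ X, Chain (L ++ L') X ∧ X 0 = x ∧ X L.length = y := by
  induction L generalizing x with
  | nil =>
    obtain ⟨X, hX, h0⟩ := h'.exists_chain
    obtain rfl : y = x := h
    exact ⟨X, hX, h0, h0⟩
  | cons P L ih =>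
    obtain ⟨w, hw, hL⟩ := h
    obtain ⟨X, hX, rfl, hy⟩ := ih hL
    exact ⟨fun t => Nat.casesOn t x X, chain_cons.2 ⟨hw, hX⟩, rfl, hy⟩

theorem flows_append {L L' : List DiagramPiece} {x y : ℕ → G} :
    Flows (L ++ L') x y ↔ ∃ z, Flows L x z ∧ Flows L' z y := by
  induction L generalizing x with
  | nil => simp [Flows]
  | cons P L ih =>
    simp only [List.cons_append, Flows, ih]
    grind

theorem Chain.eq_one_of_le {L : List DiagramPiece} {X : ℕ → ℕ → G} (h : Chain L X) {w : ℕ}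
    (hL : Closes w L) (h0 : ∀ j, w ≤ j → X 0 j = 1) {t : ℕ} (ht : t ≤ L.length) (j : ℕ)
    (hj : (L.take t).foldl (fun w P => P.strandsBelow w) w ≤ j) : X t j = 1 := by
  induction L generalizing X w t with
  | nil =>
    obtain rfl : t = 0 := by simpa using ht
    exact h0 j (by simpa using hj)
  | cons P L ih =>
    cases t with
    | zero => exact h0 j (by simpa using hj)
    | succ t =>
      obtain ⟨hP, hL'⟩ := hL
      obtain ⟨hr, hc⟩ := chain_cons.1 h
      exact ih hc hL' (hr.eq_one_of_le hP h0) (by simpa using ht) (by simpa using hj)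

theorem Closes.foldl_eq_zero {L : List DiagramPiece} {w : ℕ} (h : Closes w L) :
    L.foldl (fun w P => P.strandsBelow w) w = 0 := by
  induction L generalizing w with
  | nil => exact h
  | cons P L ih => exact ih h.2

/-! ### Full twists -/

/-- The state below `k` full twists between the strands `i` and `i + 1`. -/
def twist (i : ℕ) (k : ℤ) (x : ℕ → G) : ℕ → G := fun j =>
  if j = i ∨ j = i + 1 then (x i * x (i + 1)) ^ (-k) * x j * (x i * x (i + 1)) ^ k else x j

theorem twist_zero (i : ℕ) (x : ℕ → G) : twist i 0 x = x := by
  funext j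
  simp [twist]

theorem twist_mul (i : ℕ) (k : ℤ) (x : ℕ → G) :
    twist i k x i * twist i k x (i + 1) = x i * x (i + 1) := by
  simp only [twist, true_or, or_true, if_true]
  generalize hu : x i * x (i + 1) = u
  calc _ = u ^ (-k) * (x i * x (i + 1)) * u ^ k := by group
    _ = u := by rw [hu]; group

/-- A twist preserves the product of its two strands, so successive twists conjugate by powers of
one element and the exponents add. -/
theorem twist_twist (i : ℕ) (k l : ℤ) (x : ℕ → G) :
    twist i k (twist i l x) = twist i (l + k) x := by
  funext j
  rw [twist, twist_mul]
  by_cases hj : j = i ∨ j = i + 1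
  · simp only [twist, hj, if_true]
    group
  · simp [twist, hj]

theorem flows_two_pos {i : ℕ} {x y : ℕ → G} :
    Flows [pos i, pos i] x y ↔ y = twist i 1 x := by
  simp only [Flows, rel_pos, exists_eq_left]
  refine Eq.congr_right (funext fun j => ?_)
  by_cases h1 : j = i
  · subst h1
    simp [twist, mul_assoc]
  by_cases h2 : j = i + 1
  · subst h2
    simp [twist, mul_assoc]
  · simp [twist, h1, h2]

theorem flows_two_neg {i : ℕ} {x y : ℕ → G} :
    Flows [neg i, neg i] x y ↔ y = twist i (-1) x := by
  simp only [Flows, rel_neg, exists_eq_left]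
  refine Eq.congr_right (funext fun j => ?_)
  by_cases h1 : j = i
  · subst h1
    simp [twist, mul_assoc]
  by_cases h2 : j = i + 1
  · subst h2
    simp [twist, mul_assoc]
  · simp [twist, h1, h2]

theorem flows_replicate {i : ℕ} {P : DiagramPiece} {e : ℤ}
    (hP : ∀ x y : ℕ → G, Flows [P, P] x y ↔ y = twist i e x) (k : ℕ) {x y : ℕ → G} :
    Flows (List.replicate (2 * k) P) x y ↔ y = twist i (k * e) x := by
  induction k generalizing x with
  | zero => simp [Flows, twist_zero]
  | succ k ih =>
    have : List.replicate (2 * (k + 1)) P = [P, P] ++ List.replicate (2 * k) P := by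
      rw [mul_add, add_comm, List.replicate_add]
      rfl
    rw [this, flows_append]
    simp only [hP, exists_eq_left, ih, twist_twist]
    push_cast
    ring_nf

theorem flows_halfTwists {i : ℕ} (k : ℤ) {x y : ℕ → G} :
    Flows (halfTwists i (2 * k)) x y ↔ y = twist i k x := by
  unfold halfTwists
  split_ifs with h
  · obtain ⟨c, rfl⟩ := Int.eq_ofNat_of_zero_le (show 0 ≤ k by omega)
    rw [show (2 * (c : ℤ)).natAbs = 2 * c by omega, flows_replicate fun _ _ => flows_two_pos]
    simp
  · obtain ⟨c, rfl⟩ : ∃ c : ℕ, k = -c := ⟨k.natAbs, by omega⟩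
    rw [show (2 * (-c : ℤ)).natAbs = 2 * c by omega, flows_replicate fun _ _ => flows_two_neg]
    simp

theorem ne_localMax_of_mem_halfTwists {i : ℕ} {k : ℤ} {P : DiagramPiece}
    (h : P ∈ halfTwists i k) (l : ℕ) : P ≠ localMax l := by
  unfold halfTwists at h
  split_ifs at h
  all_goals
    rw [List.eq_of_mem_replicate h]
    simp

end DiagramPiece

/-! ### Link groups and labellings -/

namespace LinkDiagram

open DiagramPiece

variable {G : Type*} [Group G] (D : LinkDiagram)

theorem width_eq_zero {t : ℕ} (ht : D.pieces.length ≤ t) : D.width t = 0 := by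
  rw [width, List.take_of_length_le ht]
  exact D.closes.foldl_eq_zero

theorem strand_eq_one {t j : ℕ} (h : D.width t ≤ j) : D.strand t j = 1 :=
  dif_neg (Nat.not_lt.2 h)

/-- The element of the `j`-th strand on level `t` in the group of the link. -/
def meridian (t j : ℕ) : D.LinkGroup := PresentedGroup.mk D.relators (D.strand t j)

theorem meridian_eq_one {t j : ℕ} (h : D.width t ≤ j) : D.meridian t j = 1 := by
  rw [meridian, strand_eq_one D h, map_one]

theorem chain_meridian : Chain D.pieces D.meridian := by
  intro t ht r hr
  have hr' : r ∈ PresentedGroup.mk D.relators ''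
      (D.pieces[t]).relators (D.strand t) (D.strand (t + 1)) := by
    rw [image_relators]
    exact hr
  obtain ⟨s, hs, rfl⟩ := hr'
  exact PresentedGroup.one_of_mem ⟨t, ht, hs⟩

theorem _root_.DiagramPiece.Chain.map {F : Type*} [Group F] (f : F →* G)
    {L : List DiagramPiece} {X : ℕ → ℕ → F} (h : Chain L X) :
    Chain L (fun t j => f (X t j)) := by
  intro t ht r hr
  have hr' : r ∈ f '' (L[t]).relators (X t) (X (t + 1)) := by
    rw [image_relators]
    exact hr
  obtain ⟨s, hs, rfl⟩ := hr'
  rw [h t ht s hs, map_one]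

theorem closure_meridians_eq_top {H : Subgroup D.LinkGroup}
    (h : ∀ t ≤ D.pieces.length, ∀ j, D.meridian t j ∈ H) : H = ⊤ := by
  rw [eq_top_iff, ← PresentedGroup.closure_range_of, Subgroup.closure_le]
  rintro _ ⟨⟨⟨t, j⟩, hj⟩, rfl⟩
  have ht : t ≤ D.pieces.length := by
    by_contra! ht
    exact absurd hj (by simp [D.width_eq_zero ht.le])
  have : D.meridian t j = PresentedGroup.of ⟨(t, j), hj⟩ := by
    rw [meridian, strand, dif_pos hj]
    rfl
  exact this ▸ h t ht j

theorem exists_hom_of_chain {X : ℕ → ℕ → G} (hX : Chain D.pieces X) (h0 : X 0 = 1) :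
    ∃ f : D.LinkGroup →* G, ∀ t ≤ D.pieces.length, ∀ j, f (D.meridian t j) = X t j := by
  have hlift : ∀ t ≤ D.pieces.length, ∀ j,
      FreeGroup.lift (fun q : D.Strand => X q.1.1 q.1.2) (D.strand t j) = X t j := by
    intro t ht j
    by_cases hj : j < D.width t
    · rw [strand, dif_pos hj]
      exact FreeGroup.lift_apply_of
    -- A missing strand is sent to `1`, so the labelling must be `1` there too.
    · rw [strand, dif_neg hj, map_one,
        hX.eq_one_of_le D.closes (by simp [h0]) ht j (Nat.not_lt.1 hj)]
  refine ⟨PresentedGroup.toGroup (f := fun q : D.Strand => X q.1.1 q.1.2) ?_, hlift⟩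
  rintro r ⟨t, ht, hr⟩
  have h := Set.mem_image_of_mem (FreeGroup.lift fun q : D.Strand => X q.1.1 q.1.2) hr
  rw [image_relators, funext (hlift t ht.le), funext (hlift (t + 1) ht)] at h
  exact hX t ht _ h

end LinkDiagram

/-! ### The group of `S(m, n)` -/

namespace SeifertKnot

open DiagramPiece LinkDiagram

variable {G : Type*} [Group G]

/-- The state on eight strands below the arches of the two bands, whose edges have the
elements `a, b` and `c, d`. -/
def archState (a b c d : G) : ℕ → G := fun j =>
  [a, b, b⁻¹, a⁻¹, c, d, d⁻¹, c⁻¹].getD j 1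

/-- The part of the diagram of `S(m, n)` below the arches of the two bands. -/
def lowerPieces (m n : ℤ) : List DiagramPiece :=
  [neg 3, neg 2, neg 4, neg 3] ++
    (halfTwists 0 (2 * m) ++ (halfTwists 6 (2 * n) ++
      [localMin 1, localMin 1, localMin 1, localMin 0]))

theorem pieces_eq (m n : ℤ) : (seifertKnot m n).pieces =
    [localMax 0, localMax 1, localMax 4, localMax 5] ++ lowerPieces m n := rfl

theorem eq_archState_of_flows {x : ℕ → G}
    (h : Flows [localMax 0, localMax 1, localMax 4, localMax 5] 1 x) :
    x = archState (x 0) (x 1) (x 4) (x 5) := by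
  simp only [Flows, rel_localMax] at h
  obtain ⟨y, hy, z, hz, w, hw, v, hv, rfl⟩ := h
  funext j
  rw [hv, hw, hz, hy]
  rcases lt_or_ge j 8 with hj | hj
  · interval_cases j <;> simp [archState]
  · obtain ⟨k, rfl⟩ := Nat.exists_eq_add_of_le' hj
    simp [archState]

theorem flows_archState (a b c d : G) :
    Flows [localMax 0, localMax 1, localMax 4, localMax 5] 1 (archState a b c d) := by
  simp only [Flows, rel_localMax]
  refine ⟨fun j => [a, a⁻¹].getD j 1, ?_, fun j => [a, b, b⁻¹, a⁻¹].getD j 1, ?_,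
    fun j => [a, b, b⁻¹, a⁻¹, c, c⁻¹].getD j 1, ?_, _, ?_, rfl⟩
  all_goals
    funext j
    rcases lt_or_ge j 8 with hj | hj
    · interval_cases j <;> simp [archState]
    · obtain ⟨k, rfl⟩ := Nat.exists_eq_add_of_le' hj
      simp [archState]

/-- The over-passing leg has labels `b⁻¹, a⁻¹`, which stay unchanged; each strand beneath it is
conjugated by both in turn. -/
theorem flows_band_crossing {a b c d : G} {x : ℕ → G} :
    Flows [neg 3, neg 2, neg 4, neg 3] (archState a b c d) x ↔
      x = fun j => [a, b, (a * b)⁻¹ * c * (a * b), (a * b)⁻¹ * d * (a * b), b⁻¹, a⁻¹, d⁻¹,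
        c⁻¹].getD j 1 := by
  simp only [Flows, rel_neg, exists_eq_left]
  refine Eq.congr_right (funext fun j => ?_)
  rcases lt_or_ge j 8 with hj | hj
  · interval_cases j <;> simp [archState, mul_assoc]
  · obtain ⟨k, rfl⟩ := Nat.exists_eq_add_of_le' hj
    simp [archState]

/-- The relations among the elements of the four edges of the bands which hold in the group
of `S(m, n)`: they express that the strands ending in a minimum are joined. -/
def Relations (m n : ℤ) (a b c d : G) : Prop :=
  (a * b) ^ (-m) * b * (a * b) ^ m * ((a * b)⁻¹ * c * (a * b)) = 1 ∧
  (a * b)⁻¹ * d * (a * b) * b⁻¹ = 1 ∧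
  a⁻¹ * ((d⁻¹ * c⁻¹) ^ (-n) * d⁻¹ * (d⁻¹ * c⁻¹) ^ n) = 1 ∧
  (a * b) ^ (-m) * a * (a * b) ^ m * ((d⁻¹ * c⁻¹) ^ (-n) * c⁻¹ * (d⁻¹ * c⁻¹) ^ n) = 1

theorem flows_lowerPieces {m n : ℤ} {a b c d : G} :
    Flows (lowerPieces m n) (archState a b c d) 1 ↔ Relations m n a b c d := by
  simp only [lowerPieces, flows_append, flows_band_crossing, flows_halfTwists, exists_eq_left]
  simp only [Flows, rel_localMin, Relations]
  simp [twist]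
  intros
  rfl

theorem ne_localMax_of_mem_lowerPieces {m n : ℤ} {P : DiagramPiece}
    (hP : P ∈ lowerPieces m n) (i : ℕ) : P ≠ localMax i := by
  simp only [lowerPieces, List.mem_append] at hP
  rcases hP with h | h | h | h
  · simp only [List.mem_cons, List.not_mem_nil, or_false] at h
    rcases h with rfl | rfl | rfl | rfl <;> simp
  · exact ne_localMax_of_mem_halfTwists h i
  · exact ne_localMax_of_mem_halfTwists h i
  · simp only [List.mem_cons, List.not_mem_nil, or_false] at h
    rcases h with rfl | rfl | rfl | rfl <;> simp

variable (m n : ℤ)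

theorem four_le_length : 4 ≤ (seifertKnot m n).pieces.length := by
  rw [pieces_eq, List.length_append]
  exact Nat.le_add_right _ _

theorem eq_archState_and_relations_of_chain {X : ℕ → ℕ → G}
    (hX : Chain (seifertKnot m n).pieces X) (h0 : X 0 = 1) :
    X 4 = archState (X 4 0) (X 4 1) (X 4 4) (X 4 5) ∧
      Relations m n (X 4 0) (X 4 1) (X 4 4) (X 4 5) := by
  have hend : X (seifertKnot m n).pieces.length = 1 := by
    funext j
    refine hX.eq_one_of_le (seifertKnot m n).closes (by simp [h0]) le_rfl j ?_
    rw [List.take_length, (seifertKnot m n).closes.foldl_eq_zero]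
    exact Nat.zero_le j
  rw [pieces_eq, chain_append] at hX
  have h4 := eq_archState_of_flows (h0 ▸ hX.1.flows)
  have hlow := hX.2.flows
  rw [pieces_eq, List.length_append, add_comm] at hend
  simp only [List.length_cons, List.length_nil, zero_add, Nat.reduceAdd] at hend hlow h4
  rw [hend, h4, flows_lowerPieces] at hlow
  exact ⟨h4, hlow⟩

theorem relations_hom (f : (seifertKnot m n).LinkGroup →* G) :
    Relations m n (f ((seifertKnot m n).meridian 4 0)) (f ((seifertKnot m n).meridian 4 1))
      (f ((seifertKnot m n).meridian 4 4)) (f ((seifertKnot m n).meridian 4 5)) := by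
  refine (eq_archState_and_relations_of_chain m n ((chain_meridian _).map f) ?_).2
  funext j
  rw [meridian_eq_one _ (Nat.zero_le j), map_one]
  rfl

theorem exists_hom_of_relations {a b c d : G} (h : Relations m n a b c d) :
    ∃ f : (seifertKnot m n).LinkGroup →* G,
      f ((seifertKnot m n).meridian 4 0) = a ∧ f ((seifertKnot m n).meridian 4 1) = b ∧
      f ((seifertKnot m n).meridian 4 4) = c ∧ f ((seifertKnot m n).meridian 4 5) = d := by
  obtain ⟨X, hX, hX0, hX4⟩ :=
    (flows_archState a b c d).exists_chain_append (flows_lowerPieces.2 h)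
  obtain ⟨f, hf⟩ := (seifertKnot m n).exists_hom_of_chain hX hX0
  refine ⟨f, ?_, ?_, ?_, ?_⟩
  all_goals
    rw [hf 4 (four_le_length m n), show X 4 = _ from hX4]
    rfl

theorem closure_meridians :
    Subgroup.closure {(seifertKnot m n).meridian 4 0, (seifertKnot m n).meridian 4 1,
      (seifertKnot m n).meridian 4 4, (seifertKnot m n).meridian 4 5} = ⊤ := by
  set M := (seifertKnot m n).meridian with hM
  set H := Subgroup.closure {M 4 0, M 4 1, M 4 4, M 4 5}
  have hc : Chain (seifertKnot m n).pieces M := chain_meridian _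
  have ha : M 4 0 ∈ H := Subgroup.subset_closure (by simp)
  have hb : M 4 1 ∈ H := Subgroup.subset_closure (by simp)
  have hc' : M 4 4 ∈ H := Subgroup.subset_closure (by simp)
  have hd : M 4 5 ∈ H := Subgroup.subset_closure (by simp)
  have h4 : ∀ j, M 4 j ∈ H := by
    intro j
    have h0 : M 0 = 1 := funext fun j => meridian_eq_one _ (Nat.zero_le j)
    rw [(eq_archState_and_relations_of_chain m n hc h0).1]
    rcases lt_or_ge j 8 with hj | hj
    · interval_cases j <;> simpa [archState]
    · obtain ⟨k, rfl⟩ := Nat.exists_eq_add_of_le' hj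
      simp [archState]
  -- Going up through the arches: every strand above a maximum continues below it.
  have hupper : ∀ k ≤ 4, ∀ j, M (4 - k) j ∈ H := by
    intro k
    induction k with
    | zero => exact fun _ => h4
    | succ k ih =>
      intro hk
      obtain ⟨i, hi⟩ : ∃ i, (localMax i).Rel (M (4 - (k + 1))) (M (4 - (k + 1) + 1)) := by
        have hlt : 4 - (k + 1) < (seifertKnot m n).pieces.length :=
          lt_of_lt_of_le (by omega) (four_le_length m n)
        have h := hc _ hlt
        have hk3 : k ≤ 3 := by omega
        interval_cases k <;> exact ⟨_, h⟩
      refine hi.mem_above_localMax ?_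
      rw [show 4 - (k + 1) + 1 = 4 - k by omega]
      exact ih (by omega)
  -- Going down, only crossings and minima occur, which create no labels outside `H`.
  have hlower : ∀ k, 4 + k ≤ (seifertKnot m n).pieces.length → ∀ j, M (4 + k) j ∈ H := by
    intro k
    induction k with
    | zero => exact fun _ => h4
    | succ k ih =>
      intro hk
      have hlt : 4 + k < (seifertKnot m n).pieces.length := by omega
      refine (hc (4 + k) hlt).mem_below (fun i => ?_) (ih (by omega))
      refine ne_localMax_of_mem_lowerPieces (m := m) (n := n) ?_ i
      simp only [pieces_eq]
      rw [List.getElem_append_right (by simp)]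
      exact List.getElem_mem _
  refine closure_meridians_eq_top _ fun t ht j => ?_
  rcases le_total t 4 with h | h
  · have := hupper (4 - t) (by omega) j
    rwa [show 4 - (4 - t) = t by omega] at this
  · obtain ⟨k, rfl⟩ := Nat.exists_eq_add_of_le h
    exact hlower k ht j

/-- Each minimum equates a conjugate of one label with the inverse of a conjugate of another, up to
inverting labels; normal subgroups do not see the difference. -/
theorem Relations.mem_iff {m n : ℤ} {a b c d : G} (h : Relations m n a b c d)
    (N : Subgroup G) [N.Normal] : (a ∈ N ↔ b ∈ N) ∧ (c ∈ N ↔ b ∈ N) ∧ (d ∈ N ↔ b ∈ N) := by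
  have hmul : ∀ {x y : G}, x * y = 1 → (x ∈ N ↔ y ∈ N) := fun hxy => by
    rw [eq_inv_of_mul_eq_one_right hxy, N.inv_mem_iff]
  have hconj : ∀ x g : G, g⁻¹ * x * g ∈ N ↔ x ∈ N := fun x g => by
    rw [Subgroup.Normal.mem_comm_iff ‹_›]
    simp
  obtain ⟨h1, h2, h3, -⟩ := h
  have h1 := hmul h1
  have h2 := hmul h2
  have h3 := hmul h3
  simp only [zpow_neg, hconj, N.inv_mem_iff] at h1 h2 h3
  tauto

end SeifertKnot

/-! ### Subgroups and automorphisms of the dihedral group -/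

namespace DihedralGroup

variable {p : ℕ}

/-- The subgroup of the rotations. -/
def rotations (p : ℕ) : Subgroup (DihedralGroup p) where
  carrier := Set.range r
  one_mem' := ⟨0, r_zero⟩
  mul_mem' := by
    rintro _ _ ⟨i, rfl⟩ ⟨j, rfl⟩
    exact ⟨i + j, (r_mul_r i j).symm⟩
  inv_mem' := by
    rintro _ ⟨i, rfl⟩
    exact ⟨-i, (inv_r i).symm⟩

theorem sr_notMem_rotations (i : ZMod p) : sr i ∉ rotations p := by
  rintro ⟨j, hj⟩
  cases hj

theorem exists_eq_sr_of_notMem_rotations {g : DihedralGroup p} (h : g ∉ rotations p) :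
    ∃ i, g = sr i := by
  cases g with
  | r i => exact absurd ⟨i, rfl⟩ h
  | sr i => exact ⟨i, rfl⟩

instance rotations_normal : (rotations p).Normal where
  conj_mem := by
    rintro _ ⟨i, rfl⟩ (j | j)
    · exact ⟨j + i - j, by simp [sub_eq_add_neg]⟩
    · exact ⟨j - (j + i), by simp⟩

/-- The subgroup of the rotations by the elements of an ideal `I`, and of the reflections whose
index is congruent to `k` modulo `I`. -/
def idealSubgroup (I : Ideal (ZMod p)) (k : ZMod p) : Subgroup (DihedralGroup p) where
  carrier := {g | (∃ i ∈ I, g = r i) ∨ ∃ i ∈ I, g = sr (k + i)}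
  one_mem' := Or.inl ⟨0, I.zero_mem, rfl⟩
  mul_mem' := by
    rintro _ _ (⟨i, hi, rfl⟩ | ⟨i, hi, rfl⟩) (⟨j, hj, rfl⟩ | ⟨j, hj, rfl⟩)
    · exact Or.inl ⟨i + j, I.add_mem hi hj, r_mul_r i j⟩
    · exact Or.inr ⟨j - i, I.sub_mem hj hi, by rw [r_mul_sr, add_sub_assoc]⟩
    · exact Or.inr ⟨i + j, I.add_mem hi hj, by rw [sr_mul_r, add_assoc]⟩
    · exact Or.inl ⟨j - i, I.sub_mem hj hi, by rw [sr_mul_sr, add_sub_add_left_eq_sub]⟩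
  inv_mem' := by
    rintro _ (⟨i, hi, rfl⟩ | ⟨i, hi, rfl⟩)
    · exact Or.inl ⟨-i, I.neg_mem hi, inv_r i⟩
    · exact Or.inr ⟨i, hi, inv_sr _⟩

theorem sr_mem_idealSubgroup {I : Ideal (ZMod p)} {k i : ZMod p} (h : i - k ∈ I) :
    sr i ∈ idealSubgroup I k :=
  Or.inr ⟨i - k, h, by rw [add_sub_cancel]⟩

theorem eq_top_of_idealSubgroup_eq_top {I : Ideal (ZMod p)} {k : ZMod p}
    (h : idealSubgroup I k = ⊤) : I = ⊤ := by
  rw [Ideal.eq_top_iff_one]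
  rcases (h ▸ Subgroup.mem_top _ : r 1 ∈ idealSubgroup I k) with ⟨i, hi, h⟩ | ⟨i, hi, h⟩
  · rw [r.inj h]
    exact hi
  · cases h

/-- The automorphism which multiplies rotations by a unit `e` and maps the reflection `sr i`
to `sr (e * i + k)`. -/
def affineEquiv (e : (ZMod p)ˣ) (k : ZMod p) : DihedralGroup p ≃* DihedralGroup p where
  toFun
    | r i => r ((e : ZMod p) * i)
    | sr i => sr ((e : ZMod p) * i + k)
  invFun
    | r i => r ((↑e⁻¹ : ZMod p) * i)
    | sr i => sr ((↑e⁻¹ : ZMod p) * (i - k))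
  left_inv := by rintro (i | i) <;> simp
  right_inv := by rintro (i | i) <;> simp
  map_mul' := by
    rintro (i | i) (j | j)
    · simp [mul_add]
    · simp only [r_mul_sr]
      ring_nf
    · simp only [sr_mul_r]
      ring_nf
    · simp only [sr_mul_sr]
      ring_nf

theorem affineEquiv_sr (e : (ZMod p)ˣ) (k i : ZMod p) :
    affineEquiv e k (sr i) = sr ((e : ZMod p) * i + k) := rfl

theorem eq_top_of_sr_zero_mem_of_sr_one_mem {H : Subgroup (DihedralGroup p)}
    (h0 : sr 0 ∈ H) (h1 : sr 1 ∈ H) : H = ⊤ := by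
  have hr : ∀ i, r i ∈ H := fun i => by
    have h := H.zpow_mem (H.mul_mem h0 h1) (i.cast : ℤ)
    rwa [sr_mul_sr, sub_zero, r_one_zpow, ZMod.intCast_zmod_cast] at h
  refine (Subgroup.eq_top_iff' H).2 ?_
  rintro (i | i)
  · exact hr i
  · have h := H.mul_mem h0 (hr i)
    rwa [sr_mul_r, zero_add] at h

end DihedralGroup

/-! ### Dihedral colourings of `S(m, n)` -/

namespace SeifertKnot

open DihedralGroup

variable {m n : ℤ} {p : ℕ}

theorem relations_sr {α β γ δ : ZMod p} :
    Relations m n (sr α) (sr β) (sr γ) (sr δ) ↔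
      δ = α - (β - α) ∧ γ = α + (2 * m - 1) * (β - α) ∧ (4 * m * n - 1) * (β - α) = 0 := by
  simp only [Relations, sr_mul_sr, r_zpow, inv_r, inv_sr, r_mul_sr, sr_mul_r, one_def,
    r.injEq, Int.cast_neg]
  constructor
  -- For reflections, the relation of the outermost minimum follows from the other three.
  · rintro ⟨h1, h2, h3, -⟩
    obtain rfl : δ = α - (β - α) := by linear_combination -h2
    obtain rfl : γ = α + (2 * m - 1) * (β - α) := by linear_combination h1
    exact ⟨rfl, rfl, by linear_combination h3⟩
  · rintro ⟨rfl, rfl, h⟩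
    exact ⟨by ring, by ring, by linear_combination h, by linear_combination h⟩

theorem exists_eq_sr_of_surjective {f : (seifertKnot m n).LinkGroup →* DihedralGroup p}
    (hf : Function.Surjective f) :
    ∃ (α : ZMod p) (u : (ZMod p)ˣ), (4 * m * n - 1 : ZMod p) = 0 ∧
      f ((seifertKnot m n).meridian 4 0) = sr α ∧
      f ((seifertKnot m n).meridian 4 1) = sr (α + (u : ZMod p)) ∧
      f ((seifertKnot m n).meridian 4 4) = sr (α + (2 * (m : ZMod p) - 1) * (u : ZMod p)) ∧
      f ((seifertKnot m n).meridian 4 5) = sr (α - (u : ZMod p)) := by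
  have hgen : ∀ H : Subgroup (DihedralGroup p),
      f ((seifertKnot m n).meridian 4 0) ∈ H → f ((seifertKnot m n).meridian 4 1) ∈ H →
      f ((seifertKnot m n).meridian 4 4) ∈ H → f ((seifertKnot m n).meridian 4 5) ∈ H →
      H = ⊤ := by
    intro H ha hb hc hd
    have hle : (⊤ : Subgroup (seifertKnot m n).LinkGroup) ≤ H.comap f := by
      rw [← closure_meridians m n, Subgroup.closure_le]
      rintro _ (rfl | rfl | rfl | rfl)
      exacts [ha, hb, hc, hd]
    refine (Subgroup.eq_top_iff' H).2 fun g => ?_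
    obtain ⟨x, rfl⟩ := hf g
    exact hle (Subgroup.mem_top x)
  have hrel := relations_hom m n f
  obtain ⟨ha, hc, hd⟩ := hrel.mem_iff (rotations p)
  -- One rotation would make all four generators rotations, and no reflection would be hit.
  have hb : f ((seifertKnot m n).meridian 4 1) ∉ rotations p := by
    intro hb
    have htop := hgen _ (ha.2 hb) hb (hc.2 hb) (hd.2 hb)
    exact sr_notMem_rotations (0 : ZMod p) (htop ▸ Subgroup.mem_top _)
  obtain ⟨α, hα⟩ := exists_eq_sr_of_notMem_rotations (mt ha.1 hb)
  obtain ⟨β, hβ⟩ := exists_eq_sr_of_notMem_rotations hb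
  obtain ⟨γ, hγ⟩ := exists_eq_sr_of_notMem_rotations (mt hc.1 hb)
  obtain ⟨δ, hδ⟩ := exists_eq_sr_of_notMem_rotations (mt hd.1 hb)
  rw [hα, hβ, hγ, hδ] at hrel hgen
  obtain ⟨rfl, rfl, h⟩ := relations_sr.1 hrel
  -- The differences of the indices from `α` are `0`, `1`, `2m - 1` and `-1` times `β - α`. Working
  -- with ideals covers composite `p`.
  have hI := eq_top_of_idealSubgroup_eq_top (hgen (idealSubgroup (Ideal.span {β - α}) α)
    (sr_mem_idealSubgroup (by simp))
    (sr_mem_idealSubgroup (Ideal.mem_span_singleton_self _))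
    (sr_mem_idealSubgroup (Ideal.mem_span_singleton.2 ⟨2 * m - 1, by ring⟩))
    (sr_mem_idealSubgroup (Ideal.mem_span_singleton.2 ⟨-1, by ring⟩)))
  obtain ⟨u, hu⟩ := Ideal.span_singleton_eq_top.1 hI
  rw [← hu] at h hγ hδ
  refine ⟨α, u, (Units.mul_left_eq_zero u).1 h, hα, ?_, hγ, hδ⟩
  rw [hβ, hu, add_sub_cancel]

theorem four_mul_mul_modEq_one_iff :
    4 * m * n ≡ 1 [ZMOD (p : ℤ)] ↔ (4 * m * n - 1 : ZMod p) = 0 := by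
  rw [← ZMod.intCast_eq_intCast_iff, sub_eq_zero]
  push_cast
  rfl

theorem pColourable_iff :
    (seifertKnot m n).PColourable p ↔ 4 * m * n ≡ 1 [ZMOD (p : ℤ)] := by
  rw [four_mul_mul_modEq_one_iff]
  constructor
  · rintro ⟨ρ⟩
    obtain ⟨-, -, h, -⟩ := exists_eq_sr_of_surjective ρ.surjective
    exact h
  · intro h
    have hrel := (relations_sr (m := m) (n := n) (α := (0 : ZMod p)) (β := 1)).2
      ⟨rfl, rfl, by rw [h, zero_mul]⟩
    obtain ⟨f, ha, hb, -, -⟩ := exists_hom_of_relations m n hrel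
    exact ⟨⟨f, MonoidHom.range_eq_top.1
      (eq_top_of_sr_zero_mem_of_sr_one_mem ⟨_, ha⟩ ⟨_, hb⟩)⟩⟩

theorem exists_mulEquiv_of_pColouring (ρ ρ' : (seifertKnot m n).PColouring p) :
    ∃ φ : DihedralGroup p ≃* DihedralGroup p, ∀ g, ρ'.hom g = φ (ρ.hom g) := by
  obtain ⟨α, u, -, ha, hb, hc, hd⟩ := exists_eq_sr_of_surjective ρ.surjective
  obtain ⟨α', u', -, ha', hb', hc', hd'⟩ := exists_eq_sr_of_surjective ρ'.surjective
  -- The factor matches the differences `u`, `u'`; the translation then takes `α` to `α'`.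
  let e := u' * u⁻¹
  have he : (e : ZMod p) * u = u' := by simp [e]
  let φ := affineEquiv e (α' - (e : ZMod p) * α)
  refine ⟨φ, fun g => DFunLike.congr_fun (f := ρ'.hom) (g := φ.toMonoidHom.comp ρ.hom) ?_ g⟩
  refine MonoidHom.eq_of_eqOn_dense (closure_meridians m n) ?_
  rintro _ (rfl | rfl | rfl | rfl)
  · rw [ha', MonoidHom.comp_apply, ha]
    refine (congrArg sr ?_).trans (affineEquiv_sr _ _ _).symm
    ring
  · rw [hb', MonoidHom.comp_apply, hb]
    refine (congrArg sr ?_).trans (affineEquiv_sr _ _ _).symm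
    linear_combination -he
  · rw [hc', MonoidHom.comp_apply, hc]
    refine (congrArg sr ?_).trans (affineEquiv_sr _ _ _).symm
    linear_combination -(2 * m - 1 : ZMod p) * he
  · rw [hd', MonoidHom.comp_apply, hd]
    refine (congrArg sr ?_).trans (affineEquiv_sr _ _ _).symm
    linear_combination he

end SeifertKnot

theorem propositionP (m n : ℤ) (p : ℕ) (hp : Odd p) :
    ((seifertKnot m n).PColourable p ↔ 4 * m * n ≡ 1 [ZMOD (p : ℤ)]) ∧
    (¬ 4 * m * n ≡ 1 [ZMOD (p : ℤ) ^ 2] →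
      ∀ ρ ρ' : (seifertKnot m n).PColouring p,
        ∃ φ : DihedralGroup p ≃* DihedralGroup p, ∀ g, ρ'.hom g = φ (ρ.hom g)) :=
  ⟨SeifertKnot.pColourable_iff, fun _ => SeifertKnot.exists_mulEquiv_of_pColouring⟩
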